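/- Let $n$ be a positive integer and let $V$ be an $n$-dimensional unitary space over the field $\mathbb{F}_4$ with four elements, that is, an $n$-dimensional $\mathbb{F}_4$-vector space with a nondegenerate Hermitian form $(\cdot,\cdot)$ (linear in the second argument, and with $(w,v)=\overline{(v,w)}$, where $\overline{x}=x^2$). For a nonzero singular vector $v\in V$ (that is, $(v,v)=0$) let $t(v)$ be the transvection $w\mapsto w+(v,w)v$. Let $U_n(2)$ denote either the full isometry group of $V$ or its subgroup generated by all these transvections. Let $G$ be a group isomorphic to $U_n(2)$, and let $D\subseteq G$ be the set of elements corresponding under the isomorphism to the transvections $t(v)$, where $v$ runs over the nonzero singular vectors of $V$. Let $\varphi(G)$ denote the largest integer $m$ for which there is an injective group homomorphism $S_m\to G$ sending every transposition $(i\,j)$ to an element of $D$. Then this largest integer exists when $n\ge 4$, and $$\varphi(G)=n+1 \text{ if } n\ge 5 \text{ is odd},\qquad \varphi(G)=n+2 \text{ if } n\ge 4 \text{ is even}.$$ -/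

import Mathlib

/-- The set of all `m` for which there is a monomorphism from the symmetric group on `m` letters
to `G` that sends every transposition `(i j)` into the set `D`.  The number `φ(G)` is the greatest
element of this set. -/
def symmetricDegrees (G : Type*) [Group G] (D : Set G) : Set ℕ :=
  {m : ℕ | ∃ f : Equiv.Perm (Fin m) →* G, Function.Injective f ∧
    ∀ i j : Fin m, i ≠ j → f (Equiv.swap i j) ∈ D}

section Unitary

variable {F V : Type*} [Field F] [CharP F 2] [AddCommGroup V] [Module F V]

/-- A unitary form, for a field `F` with four elements, whose nontrivial automorphism is
`x ↦ x ^ 2`: a nondegenerate sesquilinear form (semilinear in the first argument, linear in the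
second) that is Hermitian, that is, `(B x y) ^ 2 = B y x`. -/
structure IsUnitaryForm (B : V →ₛₗ[frobenius F 2] V →ₗ[F] F) : Prop where
  hermitian : B.IsSymm
  nondegenerate : B.Nondegenerate

/-- The group of all linear isometries of the form `B`. -/
def isometryGroup (B : V →ₛₗ[frobenius F 2] V →ₗ[F] F) : Subgroup (V ≃ₗ[F] V) where
  carrier := {g | ∀ x y, B (g x) (g y) = B x y}
  mul_mem' := fun {a b} ha hb x y => (ha (b x) (b y)).trans (hb x y)
  one_mem' := fun _ _ => rfl
  inv_mem' := fun {a} ha x y => by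
    have h := ha (a⁻¹ x) (a⁻¹ y)
    have e : ∀ z, a (a⁻¹ z) = z := fun z => LinearEquiv.apply_symm_apply a z
    rw [e, e] at h
    exact h.symm

/-- The set of all transvections `t(v) : w ↦ w + B v w • v`, where `v` is a nonzero singular
vector. -/
def singularTransvections (B : V →ₛₗ[frobenius F 2] V →ₗ[F] F) : Set (V ≃ₗ[F] V) :=
  {g | ∃ v : V, v ≠ 0 ∧ B v v = 0 ∧ ∀ w : V, g w = w + B v w • v}

/-- The group generated by the transvections `t(v)`, where `v` is a nonzero singular vector. -/
def transvectionGroup (B : V →ₛₗ[frobenius F 2] V →ₗ[F] F) : Subgroup (V ≃ₗ[F] V) :=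
  Subgroup.closure (singularTransvections B)

end Unitary

/-!
The transvections `t(v)` and `t(w)` commute exactly when `v` and `w` are orthogonal, so a
homomorphism of a symmetric group that sends transpositions to transvections translates the
commuting relations between transpositions into inner products of singular vectors.

*Upper bound.* If `2 * k < m`, the first `2 * k` adjacent transpositions of `S_m` give `2 * k`
vectors whose Gram matrix has nonzero entries exactly between consecutive vectors. Such vectors
are linearly independent (`linearIndependent_of_path`), so `2 * k ≤ n`. Taking `2 * k = n + 1` or
`2 * k = n + 2` gives the bound for `n` odd or even.

*Lower bound.* Let `k` be the largest even number `≤ n`, take an orthonormal family `e 1, …, e k`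
(`IsUnitaryForm.exists_orthonormal`) with sum `s`, and let `ω` be a primitive cube root of unity.
The `k + 2` vectors `0`, `ω • s`, `s + ω • e i` sum to zero, are singular, and any two nonzero ones
have inner product `1`; that is, their differences behave like the differences of basis vectors
of `F ^ (k + 2)` modulo the all-ones vector. Calling the family `a`, the formula
`v ↦ v + ∑ i, B (a i) v • (a (σ i) + a i)` defines an action of the symmetric group
(`IsSimplexFamily.permMap_mul`) in which the transposition `(i j)` acts as the transvection
`t(a i + a j)`; it is faithful as soon as there are five letters.
-/

/-! ### Unitary forms over the field with four elements -/

section Form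

variable {F V : Type*} [Field F] [CharP F 2] [AddCommGroup V] [Module F V]

theorem add_self_eq_zero_of_charTwo (F : Type*) {V : Type*} [Field F] [CharP F 2]
    [AddCommGroup V] [Module F V] (x : V) : x + x = 0 := by
  rw [← two_smul F, CharTwo.two_eq_zero, zero_smul]

variable {B : V →ₛₗ[frobenius F 2] V →ₗ[F] F}

theorem IsUnitaryForm.sq_apply (hB : IsUnitaryForm B) (x y : V) : B x y ^ 2 = B y x :=
  hB.hermitian.eq x y

theorem IsUnitaryForm.apply_eq_zero_symm (hB : IsUnitaryForm B) {x y : V} (h : B x y = 0) :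
    B y x = 0 := by
  rw [← hB.sq_apply, h, zero_pow two_ne_zero]

theorem IsUnitaryForm.exists_apply_ne_zero (hB : IsUnitaryForm B) {x : V} (hx : x ≠ 0) :
    ∃ y, B x y ≠ 0 := by
  by_contra! h
  exact hx (hB.nondegenerate.1 x h)

theorem IsUnitaryForm.apply_self_eq_one (hB : IsUnitaryForm B) {x : V} (hx : B x x ≠ 0) :
    B x x = 1 := by
  have h := hB.sq_apply x x
  rw [sq] at h
  exact mul_right_cancel₀ hx (by rw [h, one_mul])

theorem apply_smul_left (B : V →ₛₗ[frobenius F 2] V →ₗ[F] F) (c : F) (x y : V) :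
    B (c • x) y = c ^ 2 * B x y := by
  rw [LinearMap.map_smulₛₗ, LinearMap.smul_apply, frobenius_def, smul_eq_mul]

/-! ### Transvections -/

theorem singularTransvections_subset_isometryGroup (hB : IsUnitaryForm B) :
    singularTransvections B ⊆ isometryGroup B := by
  rintro g ⟨v, -, hv, hg⟩ x y
  have h : B x v = B v x ^ 2 := (hB.sq_apply v x).symm
  rw [hg, hg]
  simp only [map_add, LinearMap.add_apply, map_smul, smul_eq_mul, apply_smul_left, hv, h]
  linear_combination (B v x ^ 2 * B v y) * (CharTwo.two_eq_zero : (2 : F) = 0)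

theorem transvectionGroup_le_isometryGroup (hB : IsUnitaryForm B) :
    transvectionGroup B ≤ isometryGroup B :=
  (Subgroup.closure_le _).2 (singularTransvections_subset_isometryGroup hB)

theorem commute_of_orthogonal (hB : IsUnitaryForm B) {g h : V ≃ₗ[F] V} {v w : V}
    (hg : ∀ x, g x = x + B v x • v) (hh : ∀ x, h x = x + B w x • w) (hvw : B v w = 0) :
    g * h = h * g := by
  have hwv := hB.apply_eq_zero_symm hvw
  ext x
  simp only [LinearEquiv.mul_apply, hg, hh, map_add, map_smul, hvw, hwv, smul_zero, add_zero]
  abel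

/-- If two transvections `t(v)`, `t(w)` commute while `v`, `w` are not orthogonal, then comparing
`t(v) t(w)` with `t(w) t(v)` makes `w` a multiple of `v`, whence `v ⊥ w` since `v` is singular. -/
theorem orthogonal_of_commute (hB : IsUnitaryForm B) {g h : V ≃ₗ[F] V} {v w : V}
    (hw : w ≠ 0) (hvs : B v v = 0)
    (hg : ∀ x, g x = x + B v x • v) (hh : ∀ x, h x = x + B w x • w) (hc : g * h = h * g) :
    B v w = 0 := by
  by_contra hvw
  have hwv : B w v ≠ 0 := fun h0 => hvw (hB.apply_eq_zero_symm h0)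
  have key : ∀ x, (B w x * B v w) • v = (B v x * B w v) • w := by
    intro x
    have := LinearEquiv.congr_fun hc x
    simp only [LinearEquiv.mul_apply, hg, hh, map_add, map_smul, smul_eq_mul, add_smul] at this
    have h2 : x + B w x • w + B v x • v + (B w x * B v w) • v
        = x + B w x • w + B v x • v + (B v x * B w v) • w := by
      rw [← add_assoc] at this
      rw [this]; abel
    exact add_left_cancel h2
  obtain ⟨x, hx⟩ := hB.exists_apply_ne_zero hw
  have h1 := congrArg (B v) (key x)
  rw [map_smul, map_smul, hvs, smul_zero, smul_eq_mul, eq_comm, mul_eq_zero, or_iff_left hvw,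
    mul_eq_zero, or_iff_left hwv] at h1
  have h2 := key x
  rw [h1, zero_mul, zero_smul, smul_eq_zero, mul_eq_zero, or_iff_right hx, or_iff_right hvw] at h2
  rw [h2, map_zero, LinearMap.zero_apply] at hvw
  exact hvw rfl

/-! ### The upper bound -/

/-- The Gram matrix of a path with an even number of vertices is invertible. -/
theorem linearIndependent_of_path {k : ℕ} {u : ℕ → V}
    (h0 : ∀ i < 2 * k, ∀ j < 2 * k, i + 1 ≠ j → j + 1 ≠ i → B (u i) (u j) = 0)
    (h1 : ∀ i < 2 * k, ∀ j < 2 * k, i + 1 = j ∨ j + 1 = i → B (u i) (u j) ≠ 0) :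
    LinearIndependent F (fun i : Fin (2 * k) => u i) := by
  classical
  rw [Fintype.linearIndependent_iff]
  intro g hg
  set c : ℕ → F := fun i => if h : i < 2 * k then g ⟨i, h⟩ else 0 with hc
  have hsum : ∑ i ∈ Finset.range (2 * k), c i • u i = 0 := by
    rw [Finset.sum_range, ← hg]
    exact Finset.sum_congr rfl fun i _ => by simp [hc]
  -- Pairing the relation with `u p` involves only the coefficients at the neighbours of `p`.
  have step : ∀ p < 2 * k, ∀ q < 2 * k, q + 1 = p ∨ p + 1 = q →
      (∀ r < 2 * k, r ≠ q → r + 1 = p ∨ p + 1 = r → c r = 0) → c q = 0 := by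
    intro p hp q hq hpq hr
    have h := congrArg (B (u p)) hsum
    rw [map_sum, map_zero, Finset.sum_eq_single q] at h
    · rw [map_smul, smul_eq_mul] at h
      exact (mul_eq_zero.1 h).resolve_right (h1 p hp q hq (by omega))
    · intro r hr' hne
      rw [Finset.mem_range] at hr'
      rw [map_smul, smul_eq_mul]
      by_cases hn : r + 1 = p ∨ p + 1 = r
      · rw [hr r hr' hne hn, zero_mul]
      · rw [h0 p hp r hr' (by omega) (by omega), mul_zero]
    · intro h'
      exact absurd (Finset.mem_range.2 hq) h'
  -- The odd coefficients vanish from the beginning of the path onwards, the even ones from its end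
  -- backwards.
  have odd : ∀ i, 2 * i + 1 < 2 * k → c (2 * i + 1) = 0 := by
    intro i
    induction i with
    | zero => exact fun h => step 0 (by omega) 1 (by omega) (by omega) (by intros; omega)
    | succ i ih =>
      intro h
      refine step (2 * i + 2) (by omega) _ h (by omega) fun r hr hne hn => ?_
      obtain rfl : r = 2 * i + 1 := by omega
      exact ih hr
  have even : ∀ i < k, c (2 * (k - 1 - i)) = 0 := by
    intro i
    induction i with
    | zero =>
      exact fun h => step (2 * k - 1) (by omega) _ (by omega) (by omega) (by intros; omega)
    | succ i ih =>
      intro h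
      refine step (2 * (k - 1 - i) - 1) (by omega) _ (by omega) (by omega) fun r hr hne hn => ?_
      obtain rfl : r = 2 * (k - 1 - i) := by omega
      exact ih (by omega)
  intro i
  have hci : c i = g i := by simp [hc]
  rw [← hci]
  rcases Nat.even_or_odd' (i : ℕ) with ⟨j, hj | hj⟩
  · have := even (k - 1 - j) (by omega)
    rwa [show k - 1 - (k - 1 - j) = j by omega, ← hj] at this
  · rw [hj]
    exact odd j (by omega)

/-- The adjacent transpositions of the first `2 * k + 1` letters give `2 * k` singular vectors
whose Gram matrix is that of a path. -/
theorem le_finrank_of_injective_of_swap_mem [FiniteDimensional F V] (hB : IsUnitaryForm B)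
    {k m : ℕ} (hkm : 2 * k < m) {f : Equiv.Perm (Fin m) →* (V ≃ₗ[F] V)}
    (hf : Function.Injective f)
    (hs : ∀ i j : Fin m, i ≠ j → f (Equiv.swap i j) ∈ singularTransvections B) :
    2 * k ≤ Module.finrank F V := by
  have hex : ∀ i : ℕ, ∃ v : V, ∀ hi : i < 2 * k, v ≠ 0 ∧ B v v = 0 ∧
      ∀ w, f (Equiv.swap ⟨i, by omega⟩ ⟨i + 1, by omega⟩) w = w + B v w • v := by
    intro i
    by_cases hi : i < 2 * k
    · obtain ⟨v, hv⟩ := hs ⟨i, by omega⟩ ⟨i + 1, by omega⟩ (by simp)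
      exact ⟨v, fun _ => hv⟩
    · exact ⟨0, fun h => absurd h hi⟩
  choose u hu using hex
  have hind : LinearIndependent F (fun i : Fin (2 * k) => u i) := by
    refine linearIndependent_of_path (B := B) (fun i hi j hj h1 h2 => ?_) fun i hi j hj h h0 => ?_
    · by_cases hij : i = j
      · subst hij
        exact (hu i hi).2.1
      · refine orthogonal_of_commute hB (hu j hj).1 (hu i hi).2.1 (hu i hi).2.2 (hu j hj).2.2 ?_
        rw [← map_mul, ← map_mul]
        congr 1
        refine (Equiv.Perm.Disjoint.commute ?_).eq
        rw [Equiv.Perm.disjoint_iff_disjoint_support,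
          Equiv.Perm.support_swap (by simp), Equiv.Perm.support_swap (by simp)]
        simp [Fin.ext_iff]
        omega
    · have hc := hf ((map_mul f _ _).trans <| (commute_of_orthogonal hB
        (hu i hi).2.2 (hu j hj).2.2 h0).trans (map_mul f _ _).symm)
      rcases h with rfl | rfl
      · have := Equiv.congr_fun hc ⟨i, by omega⟩
        simp [Equiv.swap_apply_def, Fin.ext_iff] at this
        rw [if_neg (by omega)] at this
        simp at this
      · have := Equiv.congr_fun hc ⟨j, by omega⟩
        simp [Equiv.swap_apply_def, Fin.ext_iff] at this
        rw [if_neg (by omega)] at this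
        simp at this
  simpa using hind.fintype_card_le_finrank

/-! ### Representations of symmetric groups by transvections -/

/-- A family whose members other than `a o = 0` are singular vectors with all mutual products `1`,
and which sums to zero. The vectors `a i + a j` then have the same inner products as the vectors
`b i + b j`, where `b` is the standard basis of `F ^ ι` (`IsSimplexFamily.add_apply_add`). -/
structure IsSimplexFamily {ι : Type*} [Fintype ι] [DecidableEq ι]
    (B : V →ₛₗ[frobenius F 2] V →ₗ[F] F) (a : ι → V) (o : ι) : Prop where
  sum_eq_zero : ∑ i, a i = 0
  apply_eq : ∀ i j, B (a i) (a j) = if i = j ∨ i = o ∨ j = o then 0 else 1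

namespace IsSimplexFamily

variable {ι : Type*} [Fintype ι] [DecidableEq ι] {a : ι → V} {o : ι}

theorem apply_add (h : IsSimplexFamily B a o) (i k l : ι) :
    B (a i) (a k + a l) = (if i = k then 1 else 0) + (if i = l then 1 else 0)
      + ((if k = o then 1 else 0) + (if l = o then 1 else 0)) := by
  have key : ∀ k, B (a i) (a k) = 1 + (if i = k then 1 else 0) + (if i = o then 1 else 0)
      + (if k = o then 1 else 0) := by
    intro k
    rw [h.apply_eq]
    have h2 : (1 : F) + 1 = 0 := CharTwo.add_self_eq_zero 1
    by_cases h1 : i = k <;> by_cases h3 : i = o <;> by_cases h4 : k = o <;> simp_all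
  rw [map_add, key, key]
  linear_combination (1 + if i = o then 1 else 0) * (CharTwo.two_eq_zero : (2 : F) = 0)

theorem add_apply_add (h : IsSimplexFamily B a o) (i j k l : ι) :
    B (a i + a j) (a k + a l) = (if i = k then 1 else 0) + (if i = l then 1 else 0)
      + (if j = k then 1 else 0) + (if j = l then 1 else 0) := by
  rw [map_add B, LinearMap.add_apply, h.apply_add, h.apply_add]
  linear_combination ((if k = o then 1 else 0) + (if l = o then 1 else 0)) *
    (CharTwo.two_eq_zero : (2 : F) = 0)

end IsSimplexFamily

/-- The map `v ↦ v + ∑ i, B (a i) v • (a (σ i) + a i)`. When `a` is a simplex family, it permutes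
the vectors `a i + a j` as `σ` does and fixes every vector orthogonal to them. -/
def permMap {ι : Type*} [Fintype ι] (B : V →ₛₗ[frobenius F 2] V →ₗ[F] F) (a : ι → V)
    (σ : Equiv.Perm ι) : V →ₗ[F] V :=
  LinearMap.id + ∑ i, (B (a i)).smulRight (a (σ i) + a i)

theorem permMap_apply {ι : Type*} [Fintype ι] (a : ι → V) (σ : Equiv.Perm ι) (v : V) :
    permMap B a σ v = v + ∑ i, B (a i) v • (a (σ i) + a i) := by
  simp [permMap, LinearMap.sum_apply]

theorem permMap_one {ι : Type*} [Fintype ι] (a : ι → V) : permMap B a 1 = 1 := by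
  ext v
  simp [permMap_apply, add_self_eq_zero_of_charTwo F]

namespace IsSimplexFamily

variable {ι : Type*} [Fintype ι] [DecidableEq ι] {a : ι → V} {o : ι}

theorem permMap_add (h : IsSimplexFamily B a o) (σ : Equiv.Perm ι) (k l : ι) :
    permMap B a σ (a k + a l) = a (σ k) + a (σ l) := by
  have hz : ∑ i, a (σ i) + ∑ i, a i = 0 := by
    rw [Equiv.sum_comp σ a, h.sum_eq_zero, add_zero]
  have hs : ∑ i, B (a i) (a k + a l) • (a (σ i) + a i)
      = (a (σ k) + a k) + (a (σ l) + a l) := by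
    simp only [h.apply_add]
    -- The part of the coefficient that does not depend on `i` contributes a multiple of `hz`.
    generalize ((if k = o then (1 : F) else 0) + (if l = o then 1 else 0)) = c
    simp only [add_smul, ite_smul, one_smul, zero_smul, Finset.sum_add_distrib,
      ← Finset.smul_sum, hz, smul_zero, add_zero, Finset.sum_ite_eq', Finset.mem_univ, if_true]
  rw [permMap_apply, hs]
  have hk := add_self_eq_zero_of_charTwo F (a k)
  have hl := add_self_eq_zero_of_charTwo F (a l)
  calc _ = a (σ k) + a (σ l) + ((a k + a k) + (a l + a l)) := by abel
    _ = _ := by rw [hk, hl, add_zero, add_zero]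

theorem permMap_mul (h : IsSimplexFamily B a o) (σ τ : Equiv.Perm ι) :
    permMap B a (σ * τ) = permMap B a σ * permMap B a τ := by
  ext v
  rw [Module.End.mul_apply, permMap_apply a τ, map_add, map_sum, permMap_apply a σ v,
    permMap_apply]
  simp only [map_smul, h.permMap_add]
  rw [add_assoc, ← Finset.sum_add_distrib]
  congr 1
  refine Finset.sum_congr rfl fun i _ => ?_
  rw [← smul_add, Equiv.Perm.mul_apply]
  congr 1
  have hk := add_self_eq_zero_of_charTwo F (a (σ i))
  calc _ = a (σ (τ i)) + a i + (a (σ i) + a (σ i)) := by rw [hk, add_zero]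
    _ = _ := by abel

/-- The action of the symmetric group attached to a simplex family. -/
def permHom (h : IsSimplexFamily B a o) : Equiv.Perm ι →* (V ≃ₗ[F] V) :=
  (LinearMap.GeneralLinearGroup.generalLinearEquiv F V).toMonoidHom.comp
    (MonoidHom.toHomUnits
      { toFun := permMap B a
        map_one' := permMap_one a
        map_mul' := h.permMap_mul })

theorem permHom_apply (h : IsSimplexFamily B a o) (σ : Equiv.Perm ι) (v : V) :
    h.permHom σ v = permMap B a σ v := rfl

theorem permHom_swap_mem (h : IsSimplexFamily B a o) (hι : 5 ≤ Fintype.card ι) {i j : ι}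
    (hij : i ≠ j) : h.permHom (Equiv.swap i j) ∈ singularTransvections B := by
  refine ⟨a i + a j, fun h0 => ?_, ?_, fun w => ?_⟩
  · obtain ⟨p, hp⟩ : ∃ p, p ∉ ({i, j} : Finset ι) := by
      by_contra! hall
      have := Finset.card_le_card (fun x _ => hall x : Finset.univ ⊆ ({i, j} : Finset ι))
      have := Finset.card_le_two (a := i) (b := j)
      rw [Finset.card_univ] at *
      omega
    simp only [Finset.mem_insert, Finset.mem_singleton, not_or] at hp
    have := h.add_apply_add i p i j
    rw [h0, map_zero] at this
    simp [hij, hp] at this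
  · rw [h.add_apply_add]
    simpa [hij, hij.symm] using CharTwo.add_self_eq_zero (1 : F)
  · rw [permHom_apply, permMap_apply, ← Finset.sum_subset (Finset.subset_univ {i, j}),
      Finset.sum_pair hij, Equiv.swap_apply_left, Equiv.swap_apply_right, map_add,
      LinearMap.add_apply, add_smul, add_comm (a j) (a i)]
    intro x _ hx
    simp only [Finset.mem_insert, Finset.mem_singleton, not_or] at hx
    rw [Equiv.swap_apply_of_ne_of_ne hx.1 hx.2, add_self_eq_zero_of_charTwo F, smul_zero]

theorem permHom_injective (h : IsSimplexFamily B a o) (hι : 5 ≤ Fintype.card ι) :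
    Function.Injective h.permHom := by
  rw [injective_iff_map_eq_one]
  intro σ hσ
  have hfix : ∀ k l, a (σ k) + a (σ l) = a k + a l := fun k l => by
    rw [← h.permMap_add, ← h.permHom_apply, hσ, LinearEquiv.coe_one, id]
  ext k
  rw [Equiv.Perm.one_apply]
  by_contra hk
  have hcard : ∀ s : Finset ι, s.card ≤ 4 → ∃ p, p ∉ s := by
    intro s hs
    by_contra! hall
    have := Finset.card_le_card (fun x _ => hall x : Finset.univ ⊆ s)
    rw [Finset.card_univ] at this
    omega
  obtain ⟨l, hl⟩ := hcard {k, σ⁻¹ k} (Finset.card_le_two.trans (by norm_num))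
  obtain ⟨p, hp⟩ := hcard {k, l, σ k, σ l} Finset.card_le_four
  simp only [Finset.mem_insert, Finset.mem_singleton, not_or] at hl hp
  have hl' : k ≠ σ l := fun e => hl.2 (by simp [e])
  -- `a k + a l = a (σ k) + a (σ l)` has product `1` with `a k + a p` by its first form, and `0` by
  -- its second.
  have h1 := h.add_apply_add k p (σ k) (σ l)
  rw [hfix, h.add_apply_add] at h1
  simp [Ne.symm hl.1, hp, hl', Ne.symm hk] at h1

end IsSimplexFamily

/-! ### Orthonormal families and the lower bound -/

/-- An orthonormal family extends as long as it does not span: the orthogonal complement is nonzero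
and nondegenerate, hence contains a nonsingular vector, which has norm `1` since norms lie in the
prime field. -/
theorem IsUnitaryForm.exists_orthonormal [FiniteDimensional F V]
    (hB : IsUnitaryForm B) {ω : F} (hω : ω ^ 2 + ω = 1) (k : ℕ)
    (hk : k ≤ Module.finrank F V) :
    ∃ e : Fin k → V, ∀ i j, B (e i) (e j) = if i = j then 1 else 0 := by
  induction k with
  | zero => exact ⟨Fin.elim0, fun i => i.elim0⟩
  | succ k ih =>
    obtain ⟨e, he⟩ := ih (by omega)
    suffices hex : ∃ x, (∀ i, B (e i) x = 0) ∧ B x x ≠ 0 by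
      obtain ⟨x, hx, hxx⟩ := hex
      refine ⟨Fin.snoc e x, fun i j => ?_⟩
      induction i using Fin.lastCases with
      | last =>
        induction j using Fin.lastCases with
        | last => simpa using hB.apply_self_eq_one hxx
        | cast j => simpa [Fin.ext_iff, j.2.ne'] using hB.apply_eq_zero_symm (hx j)
      | cast i =>
        induction j using Fin.lastCases with
        | last => simpa [Fin.ext_iff, i.2.ne] using hx i
        | cast j => simpa using he i j
    -- Otherwise every vector orthogonal to the family is singular, and then, by polarization with
    -- the scalars `1` and `ω`, any two such vectors are orthogonal.
    by_contra! hall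
    have hproj : ∀ v i, B (e i) (v - ∑ j, B (e j) v • e j) = 0 := by
      intro v i
      simp [he]
    have horth : ∀ x y, (∀ i, B (e i) x = 0) → (∀ i, B (e i) y = 0) → B x y = 0 := by
      intro x y hx hy
      have h0 : ∀ c : F, c * B x y + (c * B x y) ^ 2 = 0 := by
        intro c
        have h1 := hall (x + c • y) (fun i => by simp [hx, hy])
        rw [map_add B, LinearMap.add_apply, map_add, map_add, hall x hx, apply_smul_left,
          apply_smul_left, map_smul, map_smul, hall y hy, ← hB.sq_apply x y] at h1
        simp only [smul_eq_mul] at h1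
        linear_combination h1
      have h1 := h0 1
      have h2 := h0 ω
      linear_combination h2 - ω ^ 2 * h1 - B x y * hω
        + ω ^ 2 * B x y * (CharTwo.two_eq_zero : (2 : F) = 0)
    obtain ⟨v, hv⟩ : ∃ v, v ∉ Submodule.span F (Set.range e) := by
      by_contra! htop
      have h1 := finrank_range_le_card (R := F) e
      rw [Set.finrank, Submodule.eq_top_iff'.2 htop, finrank_top, Fintype.card_fin] at h1
      omega
    have hx : v - ∑ j, B (e j) v • e j ≠ 0 := by
      intro h0
      rw [sub_eq_zero] at h0
      apply hv
      rw [h0]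
      exact Submodule.sum_mem _ fun j _ => Submodule.smul_mem _ _ (Submodule.subset_span ⟨j, rfl⟩)
    have hxe := hproj v
    generalize v - ∑ j, B (e j) v • e j = x at hx hxe
    obtain ⟨y, hy⟩ := hB.exists_apply_ne_zero hx
    have h1 := horth x _ hxe (hproj y)
    rw [map_sub, map_sum, Finset.sum_eq_zero, sub_zero] at h1
    · exact hy h1
    · intro j _
      rw [map_smul, hB.apply_eq_zero_symm (hxe j), smul_zero]

theorem exists_sq_add_self_eq_one (hF : Nat.card F = 4) : ∃ ω : F, ω ^ 2 + ω = 1 := by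
  classical
  have : Finite F := Nat.finite_of_card_ne_zero (by omega)
  have := Fintype.ofFinite F
  rw [Nat.card_eq_fintype_card] at hF
  obtain ⟨ω, hω⟩ : ∃ p, p ∉ ({0, 1} : Finset F) := by
    by_contra! hall
    have := Finset.card_le_card (fun x _ => hall x : Finset.univ ⊆ ({0, 1} : Finset F))
    have h2 := Finset.card_le_two (a := (0 : F)) (b := 1)
    rw [Finset.card_univ] at this
    omega
  simp only [Finset.mem_insert, Finset.mem_singleton, not_or] at hω
  have h4 : ω ^ 4 = ω := by rw [← hF, FiniteField.pow_card]
  refine ⟨ω, ?_⟩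
  have h : (ω * (ω - 1)) * (ω ^ 2 + ω + 1) = 0 := by linear_combination h4
  have h' := (mul_eq_zero.1 h).resolve_left (mul_ne_zero hω.1 (sub_ne_zero.2 hω.2))
  linear_combination h' - CharTwo.two_eq_zero (R := F)

/-- If `e` is an orthonormal family of even size with sum `s`, then `0`, `ω • s` and the vectors
`s + ω • e i` form a simplex family. -/
theorem isSimplexFamily_of_orthonormal {ω : F} (hω : ω ^ 2 + ω = 1) (h4 : ω ^ 3 = 1) {k : ℕ}
    (hk : Even k) {e : Fin k → V} (he : ∀ i j, B (e i) (e j) = if i = j then 1 else 0) :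
    IsSimplexFamily B
      (fun i : Option (Option (Fin k)) =>
        i.elim 0 fun j => j.elim (ω • ∑ l, e l) fun i => ∑ l, e l + ω • e i) none := by
  have hk0 : (k : F) = 0 := by
    obtain ⟨r, rfl⟩ := hk
    push_cast
    exact CharTwo.add_self_eq_zero _
  have hes : ∀ i, B (e i) (∑ l, e l) = 1 := fun i => by simp [he]
  have hse : ∀ i, B (∑ l, e l) (e i) = 1 := fun i => by simp [he, LinearMap.sum_apply]
  have hss : B (∑ l, e l) (∑ l, e l) = 0 := by
    simp [LinearMap.sum_apply, he, hk0]
  have h2 : (2 : F) = 0 := CharTwo.two_eq_zero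
  refine ⟨?_, ?_⟩
  · have hks : k • (∑ l, e l) = 0 := by rw [← Nat.cast_smul_eq_nsmul F, hk0, zero_smul]
    simp [Fintype.sum_option, Finset.sum_add_distrib, ← Finset.smul_sum, hks,
      add_self_eq_zero_of_charTwo F]
  · rintro (_ | _ | i) (_ | _ | j)
    · simp
    · simp
    · simp
    · simp
    · simp only [Option.elim, apply_smul_left, map_smul, hss]
      simp
    · simp only [Option.elim, map_add, map_smul, apply_smul_left, hss, hse]
      simp
      linear_combination h4
    · simp
    · simp only [Option.elim, map_add, LinearMap.add_apply, map_smul, apply_smul_left, hss, hes]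
      simp
      linear_combination h4
    · simp only [Option.elim, map_add, LinearMap.add_apply, hss, map_smul, hse, hes,
        apply_smul_left, he, smul_eq_mul, reduceCtorEq, or_false, Option.some.injEq]
      by_cases hij : i = j
      · simp only [hij, if_true]
        linear_combination h4 + hω + h2
      · simp only [hij, if_false]
        linear_combination hω

theorem exists_perm_hom [FiniteDimensional F V] (hF : Nat.card F = 4) (hB : IsUnitaryForm B)
    {k : ℕ} (hk : Even k) (hk4 : 4 ≤ k) (hkV : k ≤ Module.finrank F V) :
    ∃ f : Equiv.Perm (Fin (k + 2)) →* (V ≃ₗ[F] V), Function.Injective f ∧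
      ∀ i j, i ≠ j → f (Equiv.swap i j) ∈ singularTransvections B := by
  obtain ⟨ω, hω⟩ := exists_sq_add_self_eq_one hF
  have h2 : (2 : F) = 0 := CharTwo.two_eq_zero
  have h3 : ω ^ 3 = 1 := by linear_combination (ω - 1) * hω + (ω - 1) * h2
  obtain ⟨e, he⟩ := hB.exists_orthonormal hω k hkV
  have hA := isSimplexFamily_of_orthonormal hω h3 hk he
  have ε : Fin (k + 2) ≃ Option (Option (Fin k)) := Fintype.equivOfCardEq (by simp)
  have hcard : 5 ≤ Fintype.card (Option (Option (Fin k))) := by simp; omega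
  refine ⟨hA.permHom.comp ε.permCongrHom.toMonoidHom,
    (hA.permHom_injective hcard).comp ε.permCongrHom.injective, fun i j hij => ?_⟩
  have : ε.permCongr (Equiv.swap i j) = Equiv.swap (ε i) (ε j) := by
    rw [Equiv.permCongr_def, Equiv.symm_trans_swap_trans]
  show hA.permHom (ε.permCongr (Equiv.swap i j)) ∈ _
  rw [this]
  exact hA.permHom_swap_mem hcard (ε.injective.ne hij)

end Form

/-! ### Transfer to the abstract group -/

/-- A homomorphism sending transpositions to transvections has its image in the transvection
group, hence in either version of the unitary group. -/
theorem mem_symmetricDegrees_of_hom {F V : Type*} [Field F] [CharP F 2]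
    [AddCommGroup V] [Module F V] {B : V →ₛₗ[frobenius F 2] V →ₗ[F] F}
    {U : Subgroup (V ≃ₗ[F] V)} (hU : transvectionGroup B ≤ U)
    {G : Type*} [Group G] {D : Set G} (e : G ≃* U)
    (hD : ∀ g : G, g ∈ D ↔ (e g : V ≃ₗ[F] V) ∈ singularTransvections B) {m : ℕ}
    {f : Equiv.Perm (Fin m) →* (V ≃ₗ[F] V)} (hf : Function.Injective f)
    (hs : ∀ i j, i ≠ j → f (Equiv.swap i j) ∈ singularTransvections B) :
    m ∈ symmetricDegrees G D := by
  have hmem : ∀ σ, f σ ∈ U := by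
    intro σ
    induction σ using Equiv.Perm.swap_induction_on with
    | one => rw [map_one]; exact U.one_mem
    | swap_mul σ i j hij ih =>
      rw [map_mul]
      exact U.mul_mem (hU (Subgroup.subset_closure (hs i j hij))) ih
  refine ⟨e.symm.toMonoidHom.comp (f.codRestrict U hmem), ?_, fun i j hij => ?_⟩
  · exact e.symm.injective.comp ((MonoidHom.injective_codRestrict f U hmem).2 hf)
  · rw [hD]
    simpa using hs i j hij

theorem mainTheorem4 {F V : Type*} [Field F] [CharP F 2] (hF : Nat.card F = 4)
    [AddCommGroup V] [Module F V] (n : ℕ) (hV : Module.finrank F V = n)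
    (B : V →ₛₗ[frobenius F 2] V →ₗ[F] F) (hB : IsUnitaryForm B)
    (U : Subgroup (V ≃ₗ[F] V)) (hU : U = isometryGroup B ∨ U = transvectionGroup B)
    {G : Type*} [Group G] (D : Set G) (e : G ≃* U)
    (hD : ∀ g : G, g ∈ D ↔ (e g : V ≃ₗ[F] V) ∈ singularTransvections B) :
    (5 ≤ n → Odd n → IsGreatest (symmetricDegrees G D) (n + 1)) ∧
    (4 ≤ n → Even n → IsGreatest (symmetricDegrees G D) (n + 2)) := by
  have hTU : transvectionGroup B ≤ U := by
    rcases hU with rfl | rfl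
    · exact transvectionGroup_le_isometryGroup hB
    · exact le_rfl
  have lower : 4 ≤ n → ∀ k, Even k → 4 ≤ k → k ≤ n → k + 2 ∈ symmetricDegrees G D := by
    intro hn k hk hk4 hkn
    have : FiniteDimensional F V := FiniteDimensional.of_finrank_pos (by omega)
    obtain ⟨f, hf, hs⟩ := exists_perm_hom hF hB hk hk4 (by omega)
    exact mem_symmetricDegrees_of_hom hTU e hD hf hs
  have upper : 4 ≤ n → ∀ k m, m ∈ symmetricDegrees G D → 2 * k < m → 2 * k ≤ n := by
    rintro hn k m ⟨f, hf, hs⟩ hkm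
    have : FiniteDimensional F V := FiniteDimensional.of_finrank_pos (by omega)
    rw [← hV]
    exact le_finrank_of_injective_of_swap_mem hB hkm
      (f := U.subtype.comp (e.toMonoidHom.comp f))
      (U.subtype_injective.comp (e.injective.comp hf)) fun i j hij => (hD _).1 (hs i j hij)
  refine ⟨fun hn ⟨r, hr⟩ => ⟨?_, fun m hm => ?_⟩, fun hn ⟨r, hr⟩ => ⟨?_, fun m hm => ?_⟩⟩
  · have := lower (by omega) (2 * r) (even_two_mul r) (by omega) (by omega)
    rwa [show n + 1 = 2 * r + 2 by omega]
  · by_contra! hlt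
    have := upper (by omega) (r + 1) m hm (by omega)
    omega
  · exact lower hn n ⟨r, hr⟩ hn le_rfl
  · by_contra! hlt
    have := upper hn (r + 1) m hm (by omega)
    omega
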